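/- Let $d\ge 1$, let $X\subseteq\mathbb R^d$, and let $k\colon X\times X\to\mathbb R$ be a strictly positive definite kernel with reproducing kernel Hilbert space $\mathcal H(X)$. For $\beta>d/2$ let $W_2^\beta(\mathbb R^d)$ be the space of (continuous representatives of) real functions $g\in L^2(\mathbb R^d)$ with $\|g\|_{W_2^\beta(\mathbb R^d)}=\|\hat g\,(1+\|\cdot\|^2)^{\beta/2}\|_{L^2(\mathbb R^d)}<\infty$, and let $W_2^\beta(X)$ be the space of restrictions $g_{|X}$ of functions $g\in W_2^\beta(\mathbb R^d)$, with the norm $\|h\|_{W_2^\beta(X)}=\inf\{\|g\|_{W_2^\beta(\mathbb R^d)} : g\in W_2^\beta(\mathbb R^d),\ g_{|X}=h\}$. Suppose that $k$ has Sobolev regularity $\alpha>0$, that is, $\mathcal H(X)=W_2^{\alpha+d/2}(X)$ as function spaces, with equivalent norms. Let $R_1,\dots,R_q\subseteq\mathbb R$ be pairwise disjoint closed intervals (possibly unbounded) of non-zero length. For $f\in\mathcal H(X)$ put $X_j=\{x\in X: f(x)\in R_j\}$, and let $\mathcal H_{R,X}(f)$ be the set of all $h\in\mathcal H(X)$ such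 that, for every $x\in X$, $h(x)\in R_j$ if $f(x)\in R_j$ for some $j$, and $h(x)=f(x)$ otherwise. Proposition. Let $f\in\mathcal H(X)$ and suppose that for some $j\in\{1,\dots,q\}$ the set $X_j$ has non-empty interior in $\mathbb R^d$. Then $$\sup_{h\in\mathcal H_{R,X}(f)}\|h\|_{\mathcal H(X)}=+\infty .$$ Consequently the norm reduction obtained by relaxation can be arbitrarily large: $\mathcal H_{R,X}(f)$ has an element $s$ of minimal norm, and for every $M\in\mathbb R$ there is $g\in\mathcal H(X)$ with $\mathcal H_{R,X}(g)=\mathcal H_{R,X}(f)$ (so $g$ has the same relaxed minimal-norm approximation $s$) and $\|g\|_{\mathcal H(X)}-\|s\|_{\mathcal H(X)}>M$. -/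

import Mathlib

open MeasureTheory
open scoped ENNReal NNReal FourierTransform InnerProductSpace

noncomputable section

namespace RelaxedGP

/-- The Euclidean space `ℝ^d`. -/
abbrev Euc (d : ℕ) : Type := EuclideanSpace ℝ (Fin d)

/-- The norm `‖û (1 + ‖·‖²)^(β/2)‖_{L²}` of a class `u ∈ L²(ℝ^d)`, where `û` is the (unitary)
`L²` Fourier transform; the value is `∞` when `û (1 + ‖·‖²)^(β/2)` is not square-integrable.
Another normalization of the Fourier transform gives an equivalent norm. -/
def sobolevNormL2 {d : ℕ} (β : ℝ) (u : Lp ℂ 2 (volume : Measure (Euc d))) : ℝ≥0∞ :=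
  eLpNorm (fun ξ : Euc d => (((1 + ‖ξ‖ ^ 2) ^ (β / 2) : ℝ) : ℂ) * (𝓕 u) ξ) 2 volume

open Classical in
/-- The norm of `W_2^β(ℝ^d)` evaluated at a real function on `ℝ^d`; it is `∞` on functions that
are not in `L²(ℝ^d)`. -/
def sobolevNorm {d : ℕ} (β : ℝ) (g : Euc d → ℝ) : ℝ≥0∞ :=
  if hg : MemLp (fun x => (g x : ℂ)) 2 (volume : Measure (Euc d)) then
    sobolevNormL2 β (hg.toLp (fun x => (g x : ℂ)))
  else ∞

/-- The space `W_2^β(ℝ^d)` of real functions, in the range `β > d/2` where every class has exactly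
one continuous representative: an element of the space is identified with that representative,
so that its values at points, and its restriction to an arbitrary subset, make sense. -/
def sobolevSpace (d : ℕ) (β : ℝ) : Set (Euc d → ℝ) :=
  {g | Continuous g ∧ sobolevNorm β g < ∞}

/-- The space `W_2^β(X)` of restrictions to `X ⊆ ℝ^d` of the elements of `W_2^β(ℝ^d)`
(for `β > d/2`). -/
def sobolevSpaceOn {d : ℕ} (X : Set (Euc d)) (β : ℝ) : Set (X → ℝ) :=
  {h | ∃ g ∈ sobolevSpace d β, X.domRestrict g = h}

/-- The norm of `W_2^β(X)`: the infimum of the norms of the extensions in `W_2^β(ℝ^d)`. -/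
def sobolevNormOn {d : ℕ} (X : Set (Euc d)) (β : ℝ) (h : X → ℝ) : ℝ≥0∞ :=
  ⨅ g ∈ {g : Euc d → ℝ | g ∈ sobolevSpace d β ∧ X.domRestrict g = h}, sobolevNorm β g

/-- `k` is the reproducing kernel of the Hilbert space of functions `H`: `k(x, ·) ∈ H` and
`(f, k(x, ·))_H = f(x)` for all `x` and all `f ∈ H`. -/
def IsReproducingKernel {X : Type*} (H : Type*) [NormedAddCommGroup H] [InnerProductSpace ℝ H]
    [RKHS ℝ H X ℝ] (k : X → X → ℝ) : Prop :=
  ∀ x : X, ∃ kx : H, (∀ y, kx y = k x y) ∧ ∀ f : H, ⟪f, kx⟫_ℝ = f x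

/-- The kernel `k` on `X ⊆ ℝ^d`, with reproducing kernel Hilbert space `H`, has Sobolev regularity
`α`: it is strictly positive definite, and `H` coincides with `W_2^(α + d/2)(X)` as a space of
functions, with equivalent norms. -/
structure HasSobolevRegularity {d : ℕ} (X : Set (Euc d)) (H : Type*) [NormedAddCommGroup H]
    [InnerProductSpace ℝ H] [RKHS ℝ H X ℝ] (k : X → X → ℝ) (α : ℝ) : Prop where
  reproducing : IsReproducingKernel H k
  posDef : (Matrix.of k).PosDef
  range_eq : Set.range (fun (h : H) (x : X) => h x) = sobolevSpaceOn X (α + d / 2)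
  norm_equiv : ∃ c C : ℝ≥0, 0 < c ∧ ∀ h : H,
    (c : ℝ≥0∞) * ‖h‖ₑ ≤ sobolevNormOn X (α + d / 2) (fun x => h x) ∧
      sobolevNormOn X (α + d / 2) (fun x => h x) ≤ (C : ℝ≥0∞) * ‖h‖ₑ

/-- `R_1, …, R_q` are pairwise disjoint closed intervals (possibly unbounded) of the real line with
non-zero lengths. -/
structure IsRelaxationFamily {q : ℕ} (R : Fin q → Set ℝ) : Prop where
  closed : ∀ j, IsClosed (R j)
  interval : ∀ j, (R j).OrdConnected
  nontrivial : ∀ j, (R j).Nontrivial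
  disjoint : Pairwise fun i j => Disjoint (R i) (R j)

/-- The region `X_j = {x ∈ X, f(x) ∈ R_j}`, as a subset of `ℝ^d`. -/
def region {d : ℕ} (X : Set (Euc d)) (f : X → ℝ) (Rj : Set ℝ) : Set (Euc d) :=
  {x | ∃ hx : x ∈ X, f ⟨x, hx⟩ ∈ Rj}

/-- The set `H_{R,U}` of the functions `h ∈ H` such that, for all `x ∈ U`, `h(x) ∈ R_j` if
`f(x) ∈ R_j` for some `j`, and `h(x) = f(x)` otherwise. -/
def relaxedSet {X : Type*} {H : Type*} [NormedAddCommGroup H] [InnerProductSpace ℝ H]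
    [RKHS ℝ H X ℝ] {q : ℕ} (R : Fin q → Set ℝ) (U : Set X) (f : H) : Set H :=
  {h | ∀ x ∈ U, (∀ j, f x ∈ R j → h x ∈ R j) ∧ ((∀ j, f x ∉ R j) → h x = f x)}

end RelaxedGP

end

/-! The kernel function at a non-isolated point `y` lies in the closed span of the kernel functions
at the other points, because a continuous function vanishing off `y` vanishes at `y`. Hence it is
approximated by a combination of the kernel functions at finitely many points `x ≠ y`, and an
element of the space with value `1` at `y` that vanishes at these points has large norm. When
`f` takes its values in `R_j` near `y`, adding to `f` a small multiple, of the right sign, of a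
sufficiently narrow bump at `y` stays inside the relaxed set, which is therefore unbounded. The
relaxed set is closed and convex, so it has an element of minimal norm; it is also the relaxed set
of each of its elements. -/

namespace RelaxedGP

open Filter Topology Set SchwartzMap

lemma iSup_enorm_eq_top_of_forall_lt_norm {E : Type*} [SeminormedAddCommGroup E] {S : Set E}
    (hS : ∀ M : ℝ, ∃ x ∈ S, M < ‖x‖) : ⨆ x ∈ S, ‖x‖ₑ = ⊤ := by
  refine ENNReal.eq_top_of_forall_nnreal_le fun M => ?_
  obtain ⟨x, hx, hM⟩ := hS M
  have hMx : (M : ℝ≥0∞) ≤ ‖x‖ₑ := ENNReal.coe_le_coe.2 (NNReal.coe_le_coe.1 hM.le)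
  exact hMx.trans (le_iSup₂ (f := fun (x : E) _ => ‖x‖ₑ) x hx)

lemma exists_mem_forall_norm_le_of_isClosed_of_convex {H : Type*} [NormedAddCommGroup H]
    [InnerProductSpace ℝ H] [CompleteSpace H] {K : Set H} (hne : K.Nonempty) (hK : IsClosed K)
    (hconv : Convex ℝ K) : ∃ s ∈ K, ∀ h ∈ K, ‖s‖ ≤ ‖h‖ := by
  obtain ⟨s, hs, hmin⟩ := exists_norm_eq_iInf_of_complete_convex hne hK.isComplete hconv 0
  simp only [zero_sub, norm_neg] at hmin
  have hbdd : BddBelow (range fun w : K => ‖(w : H)‖) :=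
    ⟨0, forall_mem_range.2 fun _ => norm_nonneg _⟩
  exact ⟨s, hs, fun h hh => hmin.trans_le (ciInf_le hbdd ⟨h, hh⟩)⟩

section Kernel

variable {𝕜 X V H : Type*} [RCLike 𝕜] [NormedAddCommGroup V] [InnerProductSpace 𝕜 V]
  [CompleteSpace V] [NormedAddCommGroup H] [InnerProductSpace 𝕜 H] [CompleteSpace H]
  [RKHS 𝕜 H X V] {y : X}

lemma kerFun_mem_topologicalClosure_span
    (hy : ∀ h : H, (∀ x ≠ y, h x = 0) → h y = 0) (v : V) :
    RKHS.kerFun H y v ∈ (Submodule.span 𝕜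
      ((fun p : X × V => RKHS.kerFun H p.1 p.2) '' {p | p.1 ≠ y})).topologicalClosure := by
  rw [← Submodule.orthogonal_orthogonal_eq_closure, Submodule.mem_orthogonal]
  intro h hh
  have hoff : ∀ x ≠ y, h x = 0 := fun x hx => ext_inner_left 𝕜 fun w => by
    rw [inner_zero_right, ← RKHS.kerFun_inner]
    exact hh _ (Submodule.subset_span ⟨(x, w), hx, rfl⟩)
  rw [RKHS.inner_kerFun, hy h hoff, inner_zero_left]

lemma exists_finite_forall_inner_eq_zero_of_mem_span {A : Set X} {w : H}
    (hw : w ∈ Submodule.span 𝕜 ((fun p : X × V => RKHS.kerFun H p.1 p.2) '' {p | p.1 ∈ A})) :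
    ∃ T ⊆ A, T.Finite ∧ ∀ b : H, (∀ x ∈ T, b x = 0) → inner 𝕜 w b = 0 := by
  obtain ⟨l, hl, rfl⟩ := (Finsupp.mem_span_image_iff_linearCombination 𝕜).1 hw
  refine ⟨Prod.fst '' (l.support : Set (X × V)), image_subset_iff.2 hl,
    l.support.finite_toSet.image _, fun b hb => ?_⟩
  rw [Finsupp.linearCombination_apply, Finsupp.sum_inner]
  refine Finset.sum_eq_zero fun p hp => ?_
  simp [inner_smul_left, hb p.1 (mem_image_of_mem _ hp)]

lemma exists_finite_forall_lt_norm (hy : ∀ h : H, (∀ x ≠ y, h x = 0) → h y = 0) {v : V}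
    (hv : v ≠ 0) (C : ℝ) :
    ∃ T : Set X, T.Finite ∧ y ∉ T ∧ ∀ b : H, b y = v → (∀ x ∈ T, b x = 0) → C < ‖b‖ := by
  obtain ⟨w, hw, hdist⟩ := Metric.mem_closure_iff.1 (kerFun_mem_topologicalClosure_span hy v)
    (‖v‖ ^ 2 / (|C| + 1)) (by positivity)
  obtain ⟨T, hTy, hT, hwT⟩ := exists_finite_forall_inner_eq_zero_of_mem_span (A := {y}ᶜ) hw
  refine ⟨T, hT, fun hyT => hTy hyT rfl, fun b hby hbT => ?_⟩
  rw [dist_eq_norm, lt_div_iff₀ (by positivity)] at hdist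
  have hinner : inner 𝕜 (RKHS.kerFun H y v - w) b = ((‖v‖ ^ 2 : ℝ) : 𝕜) := by
    simp [inner_sub_left, hwT b hbT, hby, inner_self_eq_norm_sq_to_K]
  have hle : ‖v‖ ^ 2 ≤ ‖RKHS.kerFun H y v - w‖ * ‖b‖ := by
    simpa [hinner] using norm_inner_le_norm (𝕜 := 𝕜) (RKHS.kerFun H y v - w) b
  have hlt : |C| + 1 < ‖b‖ := lt_of_mul_lt_mul_left (hdist.trans_le hle) (norm_nonneg _)
  linarith [le_abs_self C]

end Kernel

section Relaxation

lemma exists_ne_zero_forall_add_mul_mem {𝕜 : Type*} [Field 𝕜] [LinearOrder 𝕜]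
    [IsStrictOrderedRing 𝕜] [TopologicalSpace 𝕜] [OrderTopology 𝕜] {R : Set 𝕜}
    (hR : R.OrdConnected) (hnt : R.Nontrivial) (p : 𝕜) :
    ∃ τ ≠ 0, ∀ᶠ v in 𝓝 p, v ∈ R → ∀ t ∈ Icc (0 : 𝕜) 1, v + τ * t ∈ R := by
  obtain ⟨b, hb, hbp⟩ := hnt.exists_ne p
  refine ⟨(b - p) / 2, div_ne_zero (sub_ne_zero.2 hbp) two_ne_zero, ?_⟩
  rcases hbp.lt_or_gt with hlt | hgt
  · filter_upwards [lt_mem_nhds (show (p + b) / 2 < p by linarith)] with v hv hvR t ht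
    exact hR.out hb hvR ⟨by nlinarith [ht.2], by nlinarith [ht.1]⟩
  · filter_upwards [gt_mem_nhds (show p < (p + b) / 2 by linarith)] with v hv hvR t ht
    exact hR.out hvR hb ⟨by nlinarith [ht.1], by nlinarith [ht.2]⟩

/-- The class `F` of functions contains bumps at `y` supported in arbitrarily small
neighbourhoods of `y`. -/
def HasBumpsAt {X : Type*} [TopologicalSpace X] (F : Set (X → ℝ)) (y : X) : Prop :=
  ∀ U ∈ 𝓝 y, ∃ b ∈ F, b y = 1 ∧ (∀ x, b x ∈ Icc (0 : ℝ) 1) ∧ ∀ x ∉ U, b x = 0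

variable {X H : Type*} [NormedAddCommGroup H] [InnerProductSpace ℝ H] [RKHS ℝ H X ℝ]
  {q : ℕ} {R : Fin q → Set ℝ} {f : H} {U : Set X}

lemma self_mem_relaxedSet : f ∈ relaxedSet R U f :=
  fun _ _ => ⟨fun _ h => h, fun _ => rfl⟩

lemma relaxedSet_eq_of_mem (hR : Pairwise fun i j => Disjoint (R i) (R j)) {h : H}
    (hh : h ∈ relaxedSet R U f) : relaxedSet R U h = relaxedSet R U f := by
  have hiff : ∀ x ∈ U, ∀ j, h x ∈ R j ↔ f x ∈ R j := by
    refine fun x hx j => ⟨fun hj => ?_, (hh x hx).1 j⟩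
    by_cases hex : ∃ i, f x ∈ R i
    · obtain ⟨i, hi⟩ := hex
      obtain rfl : i = j := hR.eq (not_disjoint_iff.2 ⟨h x, (hh x hx).1 i hi, hj⟩)
      exact hi
    · exact (hh x hx).2 (not_exists.1 hex) ▸ hj
  ext g
  refine forall₂_congr fun x hx => and_congr ?_ ?_
  · simp only [hiff x hx]
  · simp only [hiff x hx]
    exact forall_congr' fun hn => by rw [(hh x hx).2 hn]

lemma isClosed_relaxedSet (hR : ∀ j, IsClosed (R j)) : IsClosed (relaxedSet R U f) := by
  simp only [relaxedSet, ofPred_forall, ofPred_and]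
  refine isClosed_biInter fun x _ => IsClosed.inter ?_ ?_
  · exact isClosed_iInter fun j => isClosed_iInter fun _ =>
      (hR j).preimage (RKHS.continuous_eval x)
  · exact isClosed_iInter fun _ => isClosed_eq (RKHS.continuous_eval x) continuous_const

lemma convex_relaxedSet (hR : ∀ j, (R j).OrdConnected) : Convex ℝ (relaxedSet R U f) := by
  intro g hg h hh a b ha hb hab x hx
  refine ⟨fun j hj => ?_, fun hn => ?_⟩
  · simpa using (hR j).convex ((hg x hx).1 j hj) ((hh x hx).1 j hj) ha hb hab
  · simp [(hg x hx).2 hn, (hh x hx).2 hn, ← add_mul, hab]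

lemma mem_relaxedSet_of_forall_mem_or_eq (hR : Pairwise fun i j => Disjoint (R i) (R j))
    {j : Fin q} {h : H} (hh : ∀ x ∈ U, f x ∈ R j ∧ h x ∈ R j ∨ h x = f x) :
    h ∈ relaxedSet R U f := by
  intro x hx
  rcases hh x hx with ⟨hf, hhj⟩ | heq
  · refine ⟨fun i hi => ?_, fun hn => absurd hf (hn j)⟩
    obtain rfl : i = j := hR.eq (not_disjoint_iff.2 ⟨f x, hi, hf⟩)
    exact hhj
  · exact ⟨fun i hi => heq ▸ hi, fun _ => heq⟩

variable [TopologicalSpace X] {y : X} {j : Fin q}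

lemma exists_forall_add_smul_mem_relaxedSet (hR : Pairwise fun i j => Disjoint (R i) (R j))
    (hj : (R j).OrdConnected) (hnt : (R j).Nontrivial) (hf : ContinuousAt f y)
    (hfR : ∀ᶠ x in 𝓝 y, f x ∈ R j) :
    ∃ τ : ℝ, τ ≠ 0 ∧ ∃ W ∈ 𝓝 y, ∀ b : H, (∀ x, b x ∈ Icc (0 : ℝ) 1) → (∀ x ∉ W, b x = 0) →
      f + τ • b ∈ relaxedSet R U f := by
  obtain ⟨τ, hτ, hshift⟩ := exists_ne_zero_forall_add_mul_mem hj hnt (f y)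
  refine ⟨τ, hτ, _, hfR.and (hf.eventually hshift), fun b hb hb0 => ?_⟩
  refine mem_relaxedSet_of_forall_mem_or_eq hR (j := j) fun x _ => ?_
  by_cases hx : f x ∈ R j ∧ (f x ∈ R j → ∀ t ∈ Icc (0 : ℝ) 1, f x + τ * t ∈ R j)
  · exact Or.inl ⟨hx.1, by simpa using hx.2 hx.1 (b x) (hb x)⟩
  · exact Or.inr (by simp [hb0 x hx])

lemma exists_mem_relaxedSet_lt_norm [T1Space X] [(𝓝[≠] y).NeBot] [CompleteSpace H]
    (hcont : ∀ h : H, ContinuousAt h y) (hbump : HasBumpsAt (range fun (h : H) (x : X) => h x) y)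
    (hR : Pairwise fun i j => Disjoint (R i) (R j)) (hj : (R j).OrdConnected)
    (hnt : (R j).Nontrivial) (hfR : ∀ᶠ x in 𝓝 y, f x ∈ R j) (M : ℝ) :
    ∃ h ∈ relaxedSet R U f, M < ‖h‖ := by
  have hvanish : ∀ h : H, (∀ x ≠ y, h x = 0) → h y = 0 := fun h hh =>
    (((hcont h).eventuallyEq_nhds_iff_eventuallyEq_nhdsNE continuousAt_const).1
      (eventually_mem_nhdsWithin.mono hh)).eq_of_nhds
  obtain ⟨τ, hτ, W, hW, hmem⟩ :=
    exists_forall_add_smul_mem_relaxedSet (U := U) hR hj hnt (hcont f) hfR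
  obtain ⟨T, hT, hyT, hlarge⟩ :=
    exists_finite_forall_lt_norm hvanish one_ne_zero ((M + ‖f‖) / |τ|)
  obtain ⟨_, ⟨b, rfl⟩, hby, hb01, hb0⟩ :=
    hbump (W ∩ Tᶜ) (inter_mem hW (hT.isClosed.compl_mem_nhds hyT))
  have hbig : (M + ‖f‖) / |τ| < ‖b‖ := hlarge b hby fun x hx => hb0 x fun h => h.2 hx
  refine ⟨f + τ • b, hmem b hb01 fun x hx => hb0 x fun h => hx h.1, ?_⟩
  calc M < ‖τ • b‖ - ‖f‖ := by
        rw [norm_smul, Real.norm_eq_abs]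
        exact lt_sub_iff_add_lt.2 ((div_lt_iff₀' (abs_pos.2 hτ)).1 hbig)
    _ ≤ ‖f + τ • b‖ := by
        rw [add_comm, sub_le_iff_le_add]
        exact norm_le_add_norm_add (τ • b) f

end Relaxation

section Sobolev

variable {d : ℕ} {X : Set (Euc d)} {β : ℝ}

lemma sobolevNormL2_toLp_lt_top (β : ℝ) (S : 𝓢(Euc d, ℂ)) : sobolevNormL2 β (S.toLp 2) < ∞ := by
  rw [sobolevNormL2, toLp_fourier_eq]
  set weight : Euc d → ℂ := fun ξ => (((1 + ‖ξ‖ ^ 2) ^ (β / 2) : ℝ) : ℂ)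
  have hweight : weight.HasTemperateGrowth := by
    have := Function.hasTemperateGrowth_one_add_norm_sq_rpow (Euc d) (β / 2)
    fun_prop
  refine lt_of_eq_of_lt (eLpNorm_congr_ae ?_)
    ((smulLeftCLM ℂ weight (𝓕 S)).eLpNorm_lt_top 2 volume)
  filter_upwards [(𝓕 S).coeFn_toLp 2 (volume : Measure (Euc d))] with ξ hξ
  rw [hξ, smulLeftCLM_apply_apply hweight, smul_eq_mul]

lemma mem_sobolevSpace_of_hasCompactSupport (β : ℝ) {g : Euc d → ℝ} (hc : HasCompactSupport g)
    (hg : ContDiff ℝ (⊤ : ℕ∞) g) : g ∈ sobolevSpace d β := by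
  have hcℂ : HasCompactSupport fun x => (g x : ℂ) :=
    hc.comp_left (g := fun t : ℝ => (t : ℂ)) Complex.ofReal_zero
  let S : 𝓢(Euc d, ℂ) := hcℂ.toSchwartzMap (Complex.ofRealCLM.contDiff.comp hg)
  have hS : MemLp (fun x => (g x : ℂ)) 2 (volume : Measure (Euc d)) := S.memLp 2 volume
  refine ⟨hg.continuous, ?_⟩
  rw [sobolevNorm, dif_pos hS]
  exact sobolevNormL2_toLp_lt_top β S

lemma continuous_of_mem_sobolevSpaceOn {h : X → ℝ} (hh : h ∈ sobolevSpaceOn X β) :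
    Continuous h := by
  obtain ⟨g, hg, rfl⟩ := hh
  exact hg.1.comp continuous_subtype_val

lemma hasBumpsAt_sobolevSpaceOn (β : ℝ) (y : X) : HasBumpsAt (sobolevSpaceOn X β) y := by
  intro U hU
  obtain ⟨V, hV, hVU⟩ := (mem_nhds_subtype X y U).1 hU
  obtain ⟨ρ, hρ, hρV⟩ := Metric.mem_nhds_iff.1 hV
  let ψ : ContDiffBump (y : Euc d) := ⟨ρ / 2, ρ, half_pos hρ, half_lt_self hρ⟩
  refine ⟨_, ⟨ψ, mem_sobolevSpace_of_hasCompactSupport β ψ.hasCompactSupport ψ.contDiff, rfl⟩,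
    ψ.eventuallyEq_one.eq_of_nhds, fun x => ⟨ψ.nonneg, ψ.le_one⟩, fun x hx => ?_⟩
  exact ψ.zero_of_le_dist (not_lt.1 fun hlt => hx (hVU (hρV hlt)))

lemma exists_neBot_nhdsNE_eventually_mem_of_nonempty_interior_region [Nonempty (Fin d)]
    {f : X → ℝ} {S : Set ℝ} (hint : (interior (region X f S)).Nonempty) :
    ∃ y : X, (𝓝[≠] y).NeBot ∧ ∀ᶠ x in 𝓝 y, f x ∈ S := by
  obtain ⟨z, hz⟩ := hint
  have hnhds : region X f S ∈ 𝓝 z := mem_interior_iff_mem_nhds.1 hz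
  have hX : X ∈ 𝓝 z := mem_of_superset hnhds fun x hx => hx.1
  refine ⟨⟨z, mem_of_mem_nhds hX⟩, ?_, ?_⟩
  · rw [nhds_ne_subtype_neBot_iff,
      inf_eq_left.2 (le_principal_iff.2 (mem_nhdsWithin_of_mem_nhds hX))]
    exact Module.punctured_nhds_neBot ℝ (Euc d) z
  · filter_upwards [continuous_subtype_val.continuousAt.preimage_mem_nhds hnhds] with x hx
    exact hx.2

end Sobolev

end RelaxedGP

open Topology RelaxedGP in
theorem mainTheorem5_general {X H : Type*} [TopologicalSpace X] [T1Space X]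
    [NormedAddCommGroup H] [InnerProductSpace ℝ H] [CompleteSpace H] [RKHS ℝ H X ℝ] {y : X}
    [(𝓝[≠] y).NeBot] (hcont : ∀ h : H, ContinuousAt h y)
    (hbump : HasBumpsAt (Set.range fun (h : H) (x : X) => h x) y) {q : ℕ} {R : Fin q → Set ℝ}
    (hR : IsRelaxationFamily R) (U : Set X) {f : H} {j : Fin q}
    (hfR : ∀ᶠ x in 𝓝 y, f x ∈ R j) :
    (⨆ h ∈ relaxedSet R U f, ‖h‖ₑ) = ⊤ ∧
      ∃ s ∈ relaxedSet R U f, (∀ h ∈ relaxedSet R U f, ‖s‖ ≤ ‖h‖) ∧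
        ∀ M : ℝ, ∃ g : H, relaxedSet R U g = relaxedSet R U f ∧ M < ‖g‖ - ‖s‖ := by
  have hunbounded : ∀ M : ℝ, ∃ h ∈ relaxedSet R U f, M < ‖h‖ :=
    exists_mem_relaxedSet_lt_norm hcont hbump hR.disjoint (hR.interval j) (hR.nontrivial j) hfR
  obtain ⟨s, hs, hmin⟩ := exists_mem_forall_norm_le_of_isClosed_of_convex
    ⟨f, self_mem_relaxedSet⟩ (isClosed_relaxedSet hR.closed) (convex_relaxedSet hR.interval)
  refine ⟨iSup_enorm_eq_top_of_forall_lt_norm hunbounded, s, hs, hmin, fun M => ?_⟩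
  obtain ⟨g, hg, hM⟩ := hunbounded (M + ‖s‖)
  exact ⟨g, relaxedSet_eq_of_mem hR.disjoint hg, lt_sub_iff_add_lt.2 hM⟩

theorem mainTheorem5 {d : ℕ} (hd : 1 ≤ d) (X : Set (RelaxedGP.Euc d))
    {H : Type*} [NormedAddCommGroup H] [InnerProductSpace ℝ H] [CompleteSpace H] [RKHS ℝ H X ℝ]
    (k : X → X → ℝ) (α : ℝ) (hα : 0 < α) (hk : RelaxedGP.HasSobolevRegularity X H k α)
    {q : ℕ} (R : Fin q → Set ℝ) (hR : RelaxedGP.IsRelaxationFamily R) (f : H)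
    (hint : ∃ j, (interior (RelaxedGP.region X (fun x => f x) (R j))).Nonempty) :
    (⨆ h ∈ RelaxedGP.relaxedSet R Set.univ f, ‖h‖ₑ) = ⊤ ∧
      ∃ s ∈ RelaxedGP.relaxedSet R Set.univ f,
        (∀ h ∈ RelaxedGP.relaxedSet R Set.univ f, ‖s‖ ≤ ‖h‖) ∧
        ∀ M : ℝ, ∃ g : H,
          RelaxedGP.relaxedSet R Set.univ g = RelaxedGP.relaxedSet R Set.univ f ∧
            M < ‖g‖ - ‖s‖ := by
  have : Nonempty (Fin d) := ⟨⟨0, hd⟩⟩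
  obtain ⟨j, hj⟩ := hint
  obtain ⟨y, _, hfR⟩ :=
    RelaxedGP.exists_neBot_nhdsNE_eventually_mem_of_nonempty_interior_region hj
  exact mainTheorem5_general
    (fun h => (RelaxedGP.continuous_of_mem_sobolevSpaceOn
      (hk.range_eq ▸ Set.mem_range_self h)).continuousAt)
    (hk.range_eq ▸ RelaxedGP.hasBumpsAt_sobolevSpaceOn _ y) hR Set.univ hfR
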